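/- Definitions. For $h\ge 0$, an $h$-short segment from $x$ to $y$ in a metric space $(X,d)$ is a path $\gamma:[0,L]\to X$ from $x$ to $y$ with $\mathrm{len}(\gamma)\le d(x,y)+h$; a geodesic is a $0$-short segment. $X$ is a length space (respectively a geodesic space) if any two points are joined by an $h$-short segment for every $h>0$ (respectively by a geodesic). An $h$-short triangle consists of three points and three $h$-short segments (sides) joining them; a comparison triangle for it is a (possibly degenerate) triangle in the Euclidean plane $\mathbb R^2$ whose vertices have the same mutual distances. A comparison point for the point $u=\gamma(t)$ of the side $\gamma:[0,L]\to X$ from $x$ to $y$ is a point $\bar u\in[\bar x,\bar y]$ with $|\bar x-\bar u|\le \mathrm{len}(\gamma|_{[0,t]})$ and $|\bar u-\bar y|\le\mathrm{len}(\gamma|_{[t,L]})$. For $C>0$, a length space $X$ is $C$-rough CAT(0) if, for all $x,y,z\in X$, $h=1/\max\{1,d(x,y),d(x,z),d(y,z)\}$, every $h$-short triangle with vertices $x,y,z$, every comparison triangle, all points $u,v$ on different sides of the triangle and all comparison points $\bar u,\bar v$ for them, $d(u,v)\le|\bar u-\bar v|+C$. $X$ is rough CAT(0) if it is $C$-rough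 CAT(0) for some $C>0$. A geodesic space is CAT(0) if $d(u,v)\le|\bar u-\bar v|$ for all points $u,v$ on different sides of a geodesic triangle and their comparison points $\bar u,\bar v$. $X$ is an (unpointed) Gromov–Hausdorff limit of $X_m$ if $d_{GH}(X_m,X)\to0$, where $d_{GH}$ is the infimum of the Hausdorff distances of isometric copies in a common metric space; $(X,p)$ is a pointed Gromov–Hausdorff limit of $(X_m,q_m)$ if for every $r>0$ the closed balls $\bar B(q_m,r)$ converge to $\bar B(p,r)$ in this sense. For a non-principal ultrafilter $\omega$ on $\mathbb N$, the ultralimit $\lim_\omega(X_m,d_m,q_m)$ is the set of sequences $(x_m)\in\prod X_m$ with $d_m(x_m,q_m)$ bounded, with the metric $\lim_\omega d_m(x_m,y_m)$, sequences at distance $0$ being identified. An asymptotic cone of $(X,d)$ is $\mathrm{Cone}_\omega X=\lim_\omega(X,d/m,q_m)$ for a non-principal ultrafilter $\omega$ on $\mathbb N=\{1,2,\dots\}$ and base points $q_m\in X$ (for instance, all equal). **Corollary.** Let $(X,d)$ be a length space, and let $(X_m,d_m)$, $m\in\mathbb N$, be a sequence of $C$-rough CAT(0) spaces. Write $\tilde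 C=3C+2\sqrt3$. (a) If $X$ is an unpointed Gromov–Hausdorff limit of $(X_m)$, or a pointed Gromov–Hausdorff limit of $(X_m)$ for some choice of base points, then $X$ is $\tilde C$-rough CAT(0). (b) If $X$ is isometric to an ultralimit of $(X_m)$, for some non-principal ultrafilter on $\mathbb N$ and some choice of base points, then $X$ is $\tilde C$-rough CAT(0). (c) If $X$ is rough CAT(0), then $\mathrm{Cone}_\omega X$ is a CAT(0) space for every non-principal ultrafilter $\omega$ and every choice of base points. -/

import Mathlib

open Filter Topology

namespace RoughCAT0

universe u v

/-! ### Short segments, length spaces, geodesic spaces -/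

/-- An `h`-short segment from `x` to `y`: a (continuous) path `γ : [0, L] → X` from `x` to `y`
whose length (its total variation) is at most `d(x, y) + h`. The map is a function on `ℝ`, of
which only the values on `[0, L]` are used. -/
structure ShortSegment {X : Type u} [MetricSpace X] (h : ℝ) (x y : X) where
  /-- the right end of the parameter interval `[0, L]` -/
  L : ℝ
  /-- the path -/
  path : ℝ → X
  L_nonneg : 0 ≤ L
  continuousOn : ContinuousOn path (Set.Icc 0 L)
  source : path 0 = x
  target : path L = y
  length_le : eVariationOn path (Set.Icc 0 L) ≤ edist x y + ENNReal.ofReal h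

/-- A length space: any two points are joined by an `h`-short segment, for every `h > 0`. -/
def IsLengthSpace (X : Type u) [MetricSpace X] : Prop :=
  ∀ x y : X, ∀ h : ℝ, 0 < h → Nonempty (ShortSegment h x y)

/-- A geodesic space: any two points are joined by a geodesic, that is, a `0`-short segment. -/
def IsGeodesicSpace (X : Type u) [MetricSpace X] : Prop :=
  ∀ x y : X, Nonempty (ShortSegment 0 x y)

/-! ### Comparison with Euclidean triangles -/

/-- The Euclidean plane. -/
abbrev Plane : Type := EuclideanSpace ℝ (Fin 2)

/-- `u'` is a comparison point, on the Euclidean segment `[x', y']`, for the point `γ(t)` of the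
short segment `γ`: the distances from `u'` to the ends `x'`, `y'` are at most the lengths of the
subpaths `γ|[0, t]` and `γ|[t, L]`, respectively. -/
def IsComparisonPoint {X : Type u} [MetricSpace X] {h : ℝ} {x y : X} (γ : ShortSegment h x y)
    (t : ℝ) (x' y' u' : Plane) : Prop :=
  u' ∈ segment ℝ x' y' ∧
    edist x' u' ≤ eVariationOn γ.path (Set.Icc 0 t) ∧
    edist u' y' ≤ eVariationOn γ.path (Set.Icc t γ.L)

/-- The `C`-rough CAT(0) condition for the function `H`. The triangle has the vertices
`p 0, p 1, p 2` and the `h`-short sides `γ i` from `p i` to `p (i + 1)` (indices modulo `3`),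
with `h = H (p 0) (p 1) (p 2)`; `p'` is a comparison triangle; `u = γ i s` and `v = γ j t` lie on
different sides, and `u'`, `v'` are any comparison points for them. -/
def RoughCAT0Condition (X : Type u) [MetricSpace X] (C : ℝ) (H : X → X → X → ℝ) : Prop :=
  ∀ (p : Fin 3 → X)
    (γ : ∀ i : Fin 3, ShortSegment (H (p 0) (p 1) (p 2)) (p i) (p (i + 1)))
    (p' : Fin 3 → Plane), (∀ i j, dist (p' i) (p' j) = dist (p i) (p j)) →
    ∀ i j : Fin 3, i ≠ j →
    ∀ s ∈ Set.Icc 0 (γ i).L, ∀ t ∈ Set.Icc 0 (γ j).L,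
    ∀ u' v' : Plane,
      IsComparisonPoint (γ i) s (p' i) (p' (i + 1)) u' →
      IsComparisonPoint (γ j) t (p' j) (p' (j + 1)) v' →
      dist ((γ i).path s) ((γ j).path t) ≤ dist u' v' + C

/-- `X` is a `C`-rough CAT(0) space: `C > 0`, `X` is a length space and satisfies the `C`-rough
CAT(0) condition with `H(x, y, z) = 1 / max (1, d(x, y), d(x, z), d(y, z))`. -/
def IsRoughCAT0 (C : ℝ) (X : Type u) [MetricSpace X] : Prop :=
  0 < C ∧ IsLengthSpace X ∧
    RoughCAT0Condition X C
      (fun x y z => 1 / max (max (max 1 (dist x y)) (dist x z)) (dist y z))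

/-- `X` is a CAT(0) space: it is geodesic, and distances between points on different sides of a
geodesic triangle are at most the distances of the comparison points. -/
def IsCAT0 (X : Type u) [MetricSpace X] : Prop :=
  IsGeodesicSpace X ∧ RoughCAT0Condition X 0 (fun _ _ _ => 0)

/-! ### Gromov-Hausdorff limits -/

/-- The (extended) Gromov-Hausdorff distance of two metric spaces: the infimum of the Hausdorff
distances of their images under isometric embeddings in a common metric space. -/
noncomputable def ghEDist (X : Type u) (Y : Type v) [MetricSpace X] [MetricSpace Y] : ENNReal :=
  ⨅ (Z : Type (max u v)) (_ : MetricSpace Z) (f : X → Z) (g : Y → Z)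
    (_ : Isometry f) (_ : Isometry g), Metric.hausdorffEDist (Set.range f) (Set.range g)

/-- `X` is an (unpointed) Gromov-Hausdorff limit of the sequence `Y`. -/
def IsGHLimit (Y : ℕ → Type v) [∀ m, MetricSpace (Y m)] (X : Type u) [MetricSpace X] : Prop :=
  Tendsto (fun m => ghEDist (Y m) X) atTop (𝓝 0)

/-- `(X, p)` is a pointed Gromov-Hausdorff limit of the sequence `(Y m, q m)`: for every `r > 0`
the closed balls of radius `r` about `q m` converge to the closed ball of radius `r` about `p`. -/
def IsPointedGHLimit (Y : ℕ → Type v) [∀ m, MetricSpace (Y m)] (q : ∀ m, Y m)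
    (X : Type u) [MetricSpace X] (p : X) : Prop :=
  ∀ r : ℝ, 0 < r →
    IsGHLimit (fun m => ↥(Metric.closedBall (q m) r)) ↥(Metric.closedBall p r)

/-! ### Ultralimits and asymptotic cones -/

/-- An ultrafilter is non-principal if it is not the ultrafilter of all sets that contain some
fixed point. -/
def NonPrincipal {ι : Type*} (ω : Ultrafilter ι) : Prop :=
  ∀ i : ι, ω ≠ pure i

/-- The families `(x i)` in `∏ Y i` at bounded distance from the base points `q i`. (The
ultrafilter `ω` is a parameter since it determines the pseudometric below.) -/
def BoundedFamily {ι : Type u} (_ω : Ultrafilter ι) (Y : ι → Type v) [∀ i, MetricSpace (Y i)]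
    (q : ∀ i, Y i) : Type (max u v) :=
  {x : ∀ i, Y i // ∃ B : ℝ, ∀ i, dist (x i) (q i) ≤ B}

/-- The `ω`-limit of the distances of two bounded families exists. -/
theorem exists_tendsto_dist {ι : Type u} (ω : Ultrafilter ι) (Y : ι → Type v)
    [∀ i, MetricSpace (Y i)] (q : ∀ i, Y i) (x y : BoundedFamily ω Y q) :
    ∃ l : ℝ, Tendsto (fun i => dist (x.1 i) (y.1 i)) ω (𝓝 l) := by
  obtain ⟨A, hA⟩ := x.2
  obtain ⟨B, hB⟩ := y.2
  have hmem : ∀ i, dist (x.1 i) (y.1 i) ∈ Set.Icc (0 : ℝ) (A + B) := fun i =>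
    ⟨dist_nonneg, (dist_triangle_right _ _ (q i)).trans (add_le_add (hA i) (hB i))⟩
  obtain ⟨l, -, hl⟩ := (isCompact_Icc (a := (0 : ℝ)) (b := A + B)).ultrafilter_le_nhds
    (ω.map fun i => dist (x.1 i) (y.1 i))
    (by
      rw [Filter.le_principal_iff]
      exact Filter.mem_map.2 (Filter.univ_mem' hmem))
  exact ⟨l, hl⟩

/-- The pseudometric `d(x, y) = lim_ω d(x i, y i)` on bounded families. -/
noncomputable instance {ι : Type u} (ω : Ultrafilter ι) (Y : ι → Type v)
    [∀ i, MetricSpace (Y i)] (q : ∀ i, Y i) : Dist (BoundedFamily ω Y q) :=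
  ⟨fun x y => limUnder (ω : Filter ι) fun i => dist (x.1 i) (y.1 i)⟩

theorem tendsto_dist {ι : Type u} (ω : Ultrafilter ι) (Y : ι → Type v)
    [∀ i, MetricSpace (Y i)] (q : ∀ i, Y i) (x y : BoundedFamily ω Y q) :
    Tendsto (fun i => dist (x.1 i) (y.1 i)) ω (𝓝 (dist x y)) :=
  tendsto_nhds_limUnder (exists_tendsto_dist ω Y q x y)

noncomputable instance {ι : Type u} (ω : Ultrafilter ι) (Y : ι → Type v)
    [∀ i, MetricSpace (Y i)] (q : ∀ i, Y i) : PseudoMetricSpace (BoundedFamily ω Y q) where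
  dist_self x := tendsto_nhds_unique (tendsto_dist ω Y q x x) (by simp)
  dist_comm x y := tendsto_nhds_unique (tendsto_dist ω Y q x y)
    (by simpa only [dist_comm] using tendsto_dist ω Y q y x)
  dist_triangle x y z := le_of_tendsto_of_tendsto' (tendsto_dist ω Y q x z)
    ((tendsto_dist ω Y q x y).add (tendsto_dist ω Y q y z)) fun _ => dist_triangle _ _ _

/-- The ultralimit `lim_ω (Y i, q i)`: the quotient of the space of bounded families that
identifies families `x`, `y` with `lim_ω d(x i, y i) = 0`, with the metric
`d([x], [y]) = lim_ω d(x i, y i)`. -/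
def Ultralimit {ι : Type u} (ω : Ultrafilter ι) (Y : ι → Type v) [∀ i, MetricSpace (Y i)]
    (q : ∀ i, Y i) : Type (max u v) :=
  SeparationQuotient (BoundedFamily ω Y q)

noncomputable instance {ι : Type u} (ω : Ultrafilter ι) (Y : ι → Type v)
    [∀ i, MetricSpace (Y i)] (q : ∀ i, Y i) : MetricSpace (Ultralimit ω Y q) :=
  inferInstanceAs (MetricSpace (SeparationQuotient (BoundedFamily ω Y q)))

/-- The set `X`, to be given the metric `d / m`. -/
def Rescaled (X : Type u) (_m : ℕ+) : Type u := X

/-- A point of `X`, seen as a point of `(X, d / m)`. -/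
def Rescaled.mk {X : Type u} (m : ℕ+) (x : X) : Rescaled X m := x

/-- The metric space `(X, d / m)`. -/
noncomputable instance (X : Type u) [MetricSpace X] (m : ℕ+) : MetricSpace (Rescaled X m) where
  dist x y := dist (α := X) x y / (m : ℝ)
  dist_self x := by
    rw [dist_self (α := X) x, zero_div]
  dist_comm x y := by
    rw [dist_comm (α := X) x y]
  dist_triangle x y z := by
    rw [← add_div]
    exact div_le_div_of_nonneg_right (dist_triangle (α := X) x y z) (Nat.cast_nonneg _)
  eq_of_dist_eq_zero := by
    intro x y h
    have hm : (m : ℝ) ≠ 0 := by exact_mod_cast m.ne_zero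
    have h0 : dist (α := X) x y = 0 := (div_eq_zero_iff.1 h).resolve_right hm
    exact (@dist_eq_zero X _ x y).1 h0

/-- The asymptotic cone `lim_ω (X, d / m)`, with respect to the base points `q m`. -/
def AsymptoticCone (ω : Ultrafilter ℕ+) (X : Type u) [MetricSpace X] (q : ℕ+ → X) : Type u :=
  Ultralimit ω (Rescaled X) fun m => Rescaled.mk m (q m)

noncomputable instance (ω : Ultrafilter ℕ+) (X : Type u) [MetricSpace X] (q : ℕ+ → X) :
    MetricSpace (AsymptoticCone ω X q) :=
  inferInstanceAs (MetricSpace (Ultralimit ω (Rescaled X) fun m => Rescaled.mk m (q m)))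

end RoughCAT0

open RoughCAT0

/-!
A rough CAT(0) condition speaks of short segments, which need not survive a limit: points on an
`h`-short side in the limit space are only approximated by points on slightly longer paths. It is
therefore replaced by an inequality on distances alone, `FivePointBound`: for a triangle
`p 0, p 1, p 2` and two further points `u`, `v`, the distance of `u` and `v` is at most `c` plus the
length of a Euclidean path from `u` to a point `w` of one side, along a comparison triangle to a
point `w'` of another side, and on to `v`. The three lengths are explicit continuous functions of
the distances (`sideDist`, and `apexDist` from Stewart's theorem), so the inequality passes to
pointwise limits of distances (`FivePointBound.of_tendsto`), and it scales
(`FivePointBound.rescaled`).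

A `C`-rough CAT(0) space satisfies the inequality with `c = 3 C` (`IsRoughCAT0.fivePointBound`):
take `w`, `w'` on sides which are so short that the rough CAT(0) condition applies to all of the
triangles `p`, `(p i, p (i + 1), u)` and `(p j, p (j + 1), v)`, once for each of the three parts.

Conversely (`FivePointBound.roughCAT0Condition`), if `u` lies on an `h`-short side of length about
`d` and `w` has the same comparison point as `u`, then the Euclidean distance of `u` and `w` is at
most `√(d h / 2 + h ^ 2)`. For `h = 1 / max (1, d, …)` this is at most `√3`, whence the constant
`3 C + 2 √3` for limits. For asymptotic cones the constant `3 C / m` tends to `0` and the sides are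
geodesics, `h = 0`, so the comparison is exact; that geodesics exist in the cone is
`IsLengthSpace.isGeodesicSpace_asymptoticCone`.
-/

namespace RoughCAT0

universe u v w

/-! ### Euclidean distances as functions of side lengths -/

/-- The distance, in a Euclidean triangle, of the apex to the point that divides the base in the
ratio `s : 1 - s`, by Stewart's theorem; `a`, `b` are the distances of the apex to the ends of the
base, and `c` is the length of the base. It is `0` if the expression under the root is negative,
which may happen if there is no such triangle. -/
noncomputable def apexDist (a b c s : ℝ) : ℝ :=
  √((1 - s) * a ^ 2 + s * b ^ 2 - s * (1 - s) * c ^ 2)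

/-- The barycentric coordinates of the point that divides the side from vertex `i` to vertex
`i + 1` of a triangle in the ratio `s : 1 - s`. -/
def sideWeight (i : Fin 3) (s : ℝ) : Fin 3 → ℝ :=
  Pi.single i (1 - s) + Pi.single (i + 1) s

/-- The distance between the points with the parameters `s`, `t` on the sides `i`, `j` of a
Euclidean triangle with side lengths `D`. -/
noncomputable def sideDist (D : Fin 3 → Fin 3 → ℝ) (i j : Fin 3) (s t : ℝ) : ℝ :=
  √((-∑ a, ∑ b, (sideWeight i s - sideWeight j t) a * (sideWeight i s - sideWeight j t) b *
    (D a b * D a b)) / 2)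

theorem sum_sideWeight (i : Fin 3) (s : ℝ) : ∑ a, sideWeight i s a = 1 := by
  simp [sideWeight, Finset.sum_add_distrib]

theorem affineCombination_sideWeight (p : Fin 3 → Plane) (i : Fin 3) (s : ℝ) :
    Finset.univ.affineCombination ℝ p (sideWeight i s) = AffineMap.lineMap (p i) (p (i + 1)) s := by
  rw [Finset.affineCombination_eq_linear_combination _ _ _ (sum_sideWeight i s),
    AffineMap.lineMap_apply_module]
  simp [sideWeight, add_smul, Finset.sum_add_distrib, Pi.single_apply, ite_smul]

theorem dist_lineMap_side (p : Fin 3 → Plane) (i j : Fin 3) (s t : ℝ) :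
    dist (AffineMap.lineMap (p i) (p (i + 1)) s : Plane) (AffineMap.lineMap (p j) (p (j + 1)) t) =
      sideDist (fun a b => dist (p a) (p b)) i j s t := by
  have h := EuclideanGeometry.dist_affineCombination (s := Finset.univ) p (sum_sideWeight i s)
    (sum_sideWeight j t)
  simp only [affineCombination_sideWeight] at h
  rw [sideDist, ← h, Real.sqrt_mul_self dist_nonneg]

theorem dist_lineMap_apex (x y z : Plane) (s : ℝ) :
    dist z (AffineMap.lineMap x y s) = apexDist (dist z x) (dist z y) (dist x y) s := by
  rw [apexDist, ← Real.sqrt_sq (dist_nonneg (x := z))]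
  congr 1
  simp only [AffineMap.lineMap_apply_module, EuclideanSpace.dist_eq, Fin.sum_univ_two,
    Real.dist_eq, sq_abs]
  rw [Real.sq_sqrt (by positivity), Real.sq_sqrt (by positivity), Real.sq_sqrt (by positivity),
    Real.sq_sqrt (by positivity)]
  simp only [PiLp.add_apply, PiLp.smul_apply, smul_eq_mul]
  ring

theorem apexDist_div (a b c s : ℝ) {m : ℝ} (hm : 0 < m) :
    apexDist (a / m) (b / m) (c / m) s = apexDist a b c s / m := by
  rw [apexDist, apexDist, ← Real.sqrt_sq hm.le, ← Real.sqrt_div' _ (sq_nonneg m)]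
  congr 1
  rw [Real.sqrt_sq hm.le]
  ring

theorem sideDist_div (D : Fin 3 → Fin 3 → ℝ) (i j : Fin 3) (s t : ℝ) {m : ℝ} (hm : 0 < m) :
    sideDist (fun a b => D a b / m) i j s t = sideDist D i j s t / m := by
  rw [sideDist, sideDist, ← Real.sqrt_sq hm.le, ← Real.sqrt_div' _ (sq_nonneg m)]
  congr 1
  rw [Real.sqrt_sq hm.le]
  simp only [Fin.sum_univ_three]
  ring

theorem tendsto_apexDist {ι : Type*} {l : Filter ι} {a b c : ι → ℝ} {a' b' c' : ℝ}
    (ha : Tendsto a l (𝓝 a')) (hb : Tendsto b l (𝓝 b')) (hc : Tendsto c l (𝓝 c')) (s : ℝ) :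
    Tendsto (fun n => apexDist (a n) (b n) (c n) s) l (𝓝 (apexDist a' b' c' s)) :=
  ((((ha.pow 2).const_mul _).add ((hb.pow 2).const_mul _)).sub ((hc.pow 2).const_mul _)).sqrt

theorem tendsto_sideDist {ι : Type*} {l : Filter ι} {D : ι → Fin 3 → Fin 3 → ℝ}
    {D' : Fin 3 → Fin 3 → ℝ} (hD : ∀ a b, Tendsto (fun n => D n a b) l (𝓝 (D' a b)))
    (i j : Fin 3) (s t : ℝ) :
    Tendsto (fun n => sideDist (D n) i j s t) l (𝓝 (sideDist D' i j s t)) :=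
  ((tendsto_finsetSum _ fun a _ => tendsto_finsetSum _ fun b _ =>
    ((hD a b).mul (hD a b)).const_mul _).neg.div_const 2).sqrt

/-- If the apex is joined to the ends of a base of length `c` by paths of lengths `A ≥ s c` and
`B ≥ (1 - s) c` with `A + B ≤ c + h`, then its distance to the point of the base at parameter `s`
is at most `√(c h / 2 + h ^ 2)`. -/
theorem apexDist_le {a b c s A B h K : ℝ} (hs : s ∈ Set.Icc (0 : ℝ) 1) (hc : 0 ≤ c) (ha : 0 ≤ a)
    (hb : 0 ≤ b) (haA : a ≤ A) (hbB : b ≤ B) (hA : s * c ≤ A) (hB : (1 - s) * c ≤ B)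
    (hAB : A + B ≤ c + h) (hK : 0 ≤ K) (hhK : c * h / 2 + h ^ 2 ≤ K ^ 2) :
    apexDist a b c s ≤ K := by
  obtain ⟨h0, h1⟩ := hs
  refine Real.sqrt_le_iff.2 ⟨hK, le_trans ?_ hhK⟩
  obtain ⟨α, rfl⟩ : ∃ α, A = s * c + α := ⟨A - s * c, by ring⟩
  obtain ⟨β, rfl⟩ : ∃ β, B = (1 - s) * c + β := ⟨B - (1 - s) * c, by ring⟩
  have hα : 0 ≤ α := by linarith
  have hβ : 0 ≤ β := by linarith
  have hαβ : α + β ≤ h := by linarith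
  have h1s : 0 ≤ 1 - s := by linarith
  have hs4 : s * (1 - s) ≤ 1 / 4 := by nlinarith [sq_nonneg (2 * s - 1)]
  have hh : 0 ≤ h := by linarith
  have e1 : (1 - s) * a ^ 2 ≤ (1 - s) * (s * c + α) ^ 2 := by gcongr
  have e2 : s * b ^ 2 ≤ s * ((1 - s) * c + β) ^ 2 := by gcongr
  have e3 : s * (1 - s) * (c * (α + β)) ≤ 1 / 4 * (c * h) := by gcongr
  have e4 : (1 - s) * α ^ 2 ≤ (1 - s) * h ^ 2 := by gcongr; linarith
  have e5 : s * β ^ 2 ≤ s * h ^ 2 := by gcongr; linarith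
  linarith

/-- Any three points of a metric space have a comparison triangle. -/
theorem exists_comparison_triangle {X : Type u} [MetricSpace X] (p : Fin 3 → X) :
    ∃ p' : Fin 3 → Plane, ∀ i j, dist (p' i) (p' j) = dist (p i) (p j) := by
  suffices h : ∃ x y z : Plane, dist x y = dist (p 0) (p 1) ∧ dist x z = dist (p 0) (p 2) ∧
      dist y z = dist (p 1) (p 2) by
    obtain ⟨x, y, z, hxy, hxz, hyz⟩ := h
    refine ⟨![x, y, z], fun i j => ?_⟩
    fin_cases i <;> fin_cases j <;> simp [hxy, hxz, hyz, dist_comm y x, dist_comm z,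
      dist_comm (p 1) (p 0), dist_comm (p 2)]
  have t1 := dist_triangle (p 0) (p 1) (p 2)
  have t2 := dist_triangle_left (p 0) (p 1) (p 2)
  have t3 := dist_triangle (p 1) (p 0) (p 2)
  rw [dist_comm (p 2) (p 0), dist_comm (p 2) (p 1)] at t2
  rw [dist_comm (p 1) (p 0)] at t3
  have n1 := dist_nonneg (x := p 0) (y := p 1)
  have n2 := dist_nonneg (x := p 0) (y := p 2)
  have n3 := dist_nonneg (x := p 1) (y := p 2)
  generalize dist (p 0) (p 1) = a at *
  generalize dist (p 0) (p 2) = b at *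
  generalize dist (p 1) (p 2) = c at *
  rcases n1.eq_or_lt with rfl | ha
  · obtain rfl : b = c := by linarith
    exact ⟨0, 0, !₂[b, 0], by simp, by simp [EuclideanSpace.dist_eq, Real.sqrt_sq n2],
      by simp [EuclideanSpace.dist_eq, Real.sqrt_sq n2]⟩
  · -- the first coordinate of the third vertex, by the law of cosines
    obtain ⟨k, hk⟩ : ∃ k, 2 * a * k = a ^ 2 + b ^ 2 - c ^ 2 :=
      ⟨(a ^ 2 + b ^ 2 - c ^ 2) / (2 * a), by field_simp⟩
    have hkb : k ≤ b := by
      refine le_of_mul_le_mul_left (a := 2 * a) ?_ (by positivity)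
      nlinarith
    have hbk : -b ≤ k := by
      refine le_of_mul_le_mul_left (a := 2 * a) ?_ (by positivity)
      nlinarith
    have hsq : 0 ≤ b ^ 2 - k ^ 2 := by nlinarith
    refine ⟨0, !₂[a, 0], !₂[k, √(b ^ 2 - k ^ 2)], ?_, ?_, ?_⟩
    · simp [EuclideanSpace.dist_eq, Real.sqrt_sq n1]
    · simp [EuclideanSpace.dist_eq, Real.sq_sqrt hsq, Real.sqrt_sq n2]
    · simp only [EuclideanSpace.dist_eq, Fin.sum_univ_two, Real.dist_eq, sq_abs]
      simp only [Matrix.cons_val_zero, Matrix.cons_val_one, zero_sub, neg_sq,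
        Real.sq_sqrt hsq]
      rw [show (a - k) ^ 2 + (b ^ 2 - k ^ 2) = c ^ 2 by linarith, Real.sqrt_sq n3]

/-! ### The five-point inequality -/

/-- The distance of two points `u`, `v` is at most the distance of the points with parameters `s`,
`t` on two sides of a comparison triangle, plus the distances of comparison apexes for `u`, `v`
to these points on their bases, plus `c`. Since it speaks of distances only, this inequality
passes to limits of metric spaces. -/
def FivePointBound (c : ℝ) (X : Type u) [MetricSpace X] : Prop :=
  ∀ (p : Fin 3 → X) (u v : X) (i j : Fin 3), i ≠ j →
    ∀ s ∈ Set.Icc (0 : ℝ) 1, ∀ t ∈ Set.Icc (0 : ℝ) 1,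
      dist u v ≤ apexDist (dist u (p i)) (dist u (p (i + 1))) (dist (p i) (p (i + 1))) s +
        sideDist (fun a b => dist (p a) (p b)) i j s t +
        apexDist (dist v (p j)) (dist v (p (j + 1))) (dist (p j) (p (j + 1))) t + c

/-- The five-point inequality passes to pointwise limits of distances. -/
theorem FivePointBound.of_tendsto {ι : Type w} {l : Filter ι} [l.NeBot] {Y : ι → Type v}
    [∀ n, MetricSpace (Y n)] {X : Type u} [MetricSpace X] {c : ι → ℝ} {c' : ℝ}
    (hY : ∀ n, FivePointBound (c n) (Y n)) (hc : Tendsto c l (𝓝 c')) (g : ∀ n, X → Y n)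
    (hg : ∀ x y, Tendsto (fun n => dist (g n x) (g n y)) l (𝓝 (dist x y))) :
    FivePointBound c' X := by
  intro p u v i j hij s hs t ht
  exact le_of_tendsto_of_tendsto' (hg u v)
    ((((tendsto_apexDist (hg _ _) (hg _ _) (hg _ _) s).add
      (tendsto_sideDist (fun a b => hg (p a) (p b)) i j s t)).add
      (tendsto_apexDist (hg _ _) (hg _ _) (hg _ _) t)).add hc)
    fun n => hY n (fun a => g n (p a)) (g n u) (g n v) i j hij s hs t ht

theorem FivePointBound.rescaled {X : Type u} [MetricSpace X] {c : ℝ} (h : FivePointBound c X)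
    (m : ℕ+) : FivePointBound (c / m) (Rescaled X m) := by
  intro p u v i j hij s hs t ht
  have hm : (0 : ℝ) < m := by exact_mod_cast m.pos
  have hd : ∀ x y : Rescaled X m, dist x y = dist (α := X) x y / (m : ℝ) := fun _ _ => rfl
  simp only [hd]
  rw [apexDist_div _ _ _ _ hm, apexDist_div _ _ _ _ hm, sideDist_div _ _ _ _ _ hm, ← add_div,
    ← add_div, ← add_div]
  exact div_le_div_of_nonneg_right (h p u v i j hij s hs t ht) hm.le

/-! ### Points on short segments -/

section ShortSegment

variable {X : Type u} [MetricSpace X] {h : ℝ} {x y : X}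

/-- A short segment is also an `h'`-short segment for larger `h'`. -/
def ShortSegment.mono (γ : ShortSegment h x y) {h' : ℝ} (hh : h ≤ h') : ShortSegment h' x y :=
  { γ with length_le := γ.length_le.trans (by gcongr) }

theorem ShortSegment.exists_dist_eq (γ : ShortSegment h x y) {s : ℝ}
    (hs : s ∈ Set.Icc (0 : ℝ) 1) :
    ∃ t ∈ Set.Icc 0 γ.L, dist x (γ.path t) = s * dist x y := by
  have hc : ContinuousOn (fun t => dist x (γ.path t)) (Set.Icc 0 γ.L) :=
    (continuous_const.dist continuous_id).comp_continuousOn γ.continuousOn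
  have := intermediate_value_Icc γ.L_nonneg hc
  rw [γ.source, γ.target, dist_self] at this
  exact this ⟨mul_nonneg hs.1 dist_nonneg, mul_le_of_le_one_left dist_nonneg hs.2⟩

theorem ShortSegment.length_add (γ : ShortSegment h x y) {t : ℝ} (ht : t ∈ Set.Icc 0 γ.L) :
    eVariationOn γ.path (Set.Icc 0 t) + eVariationOn γ.path (Set.Icc t γ.L) ≤
      edist x y + ENNReal.ofReal h := by
  have := eVariationOn.Icc_add_Icc γ.path (s := Set.univ) ht.1 ht.2 trivial
  simp only [Set.univ_inter] at this
  exact this.trans_le γ.length_le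

theorem ShortSegment.edist_le_left (γ : ShortSegment h x y) {t : ℝ} (ht : t ∈ Set.Icc 0 γ.L) :
    edist x (γ.path t) ≤ eVariationOn γ.path (Set.Icc 0 t) := by
  have := eVariationOn.edist_le γ.path (Set.left_mem_Icc.2 ht.1) (Set.right_mem_Icc.2 ht.1)
  rwa [γ.source] at this

theorem ShortSegment.edist_le_right (γ : ShortSegment h x y) {t : ℝ} (ht : t ∈ Set.Icc 0 γ.L) :
    edist (γ.path t) y ≤ eVariationOn γ.path (Set.Icc t γ.L) := by
  have := eVariationOn.edist_le γ.path (Set.left_mem_Icc.2 ht.2) (Set.right_mem_Icc.2 ht.2)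
  rwa [γ.target] at this

/-- The sum of the lengths of consecutive chords of a short segment. -/
theorem ShortSegment.dist_add_dist_add_dist_le (γ : ShortSegment h x y) (hh : 0 ≤ h) {t t' : ℝ}
    (ht : 0 ≤ t) (htt : t ≤ t') (ht' : t' ≤ γ.L) :
    dist x (γ.path t) + dist (γ.path t) (γ.path t') + dist (γ.path t') y ≤ dist x y + h := by
  have h1 := γ.length_add ⟨ht.trans htt, ht'⟩
  have h2 := eVariationOn.Icc_add_Icc γ.path (s := Set.univ) ht htt trivial
  simp only [Set.univ_inter] at h2
  have h3 := eVariationOn.edist_le γ.path (Set.left_mem_Icc.2 htt) (Set.right_mem_Icc.2 htt)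
  have h4 : edist x (γ.path t) + edist (γ.path t) (γ.path t') + edist (γ.path t') y ≤
      edist x y + ENNReal.ofReal h := by
    refine le_trans ?_ h1
    rw [← h2]
    exact add_le_add (add_le_add (γ.edist_le_left ⟨ht, htt.trans ht'⟩) h3)
      (γ.edist_le_right ⟨ht.trans htt, ht'⟩)
  simp only [edist_dist] at h4
  rw [← ENNReal.ofReal_add dist_nonneg dist_nonneg, ← ENNReal.ofReal_add (by positivity)
    dist_nonneg, ← ENNReal.ofReal_add dist_nonneg hh] at h4
  exact (ENNReal.ofReal_le_ofReal_iff (by positivity)).1 h4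

/-- A point of a short segment at distance `s * dist x y` from its start has the point with
parameter `s` as a comparison point. -/
theorem ShortSegment.isComparisonPoint_lineMap (γ : ShortSegment h x y) {s t : ℝ}
    (hs : s ∈ Set.Icc (0 : ℝ) 1) (ht : t ∈ Set.Icc 0 γ.L)
    (hst : dist x (γ.path t) = s * dist x y) {x' y' : Plane} (hd : dist x' y' = dist x y) :
    IsComparisonPoint γ t x' y' (AffineMap.lineMap x' y' s) := by
  refine ⟨lineMap_mem_segment ℝ _ _ hs, le_trans ?_ (γ.edist_le_left ht),
    le_trans ?_ (γ.edist_le_right ht)⟩ <;>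
    rw [edist_dist, edist_dist] <;> refine ENNReal.ofReal_le_ofReal ?_
  · rw [dist_left_lineMap, hd, hst, Real.norm_of_nonneg hs.1]
  · rw [dist_lineMap_right, hd, Real.norm_of_nonneg (sub_nonneg.2 hs.2)]
    linarith [dist_triangle x (γ.path t) y]

/-- Any comparison point for the point `γ t` of an `h`-short segment divides the comparison side in
some ratio `s : 1 - s`, and a comparison apex for `γ t` lies within `√(d h / 2 + h ^ 2)` of it, where
`d` is the distance of the ends of `γ`. -/
theorem IsComparisonPoint.exists_lineMap {γ : ShortSegment h x y} (hh : 0 ≤ h) {t : ℝ}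
    (ht : t ∈ Set.Icc 0 γ.L) {x' y' u' : Plane} (hd : dist x' y' = dist x y)
    (hu : IsComparisonPoint γ t x' y' u') {K : ℝ} (hK : 0 ≤ K)
    (hhK : dist x y * h / 2 + h ^ 2 ≤ K ^ 2) :
    ∃ s ∈ Set.Icc (0 : ℝ) 1, u' = AffineMap.lineMap x' y' s ∧
      apexDist (dist (γ.path t) x) (dist (γ.path t) y) (dist x y) s ≤ K := by
  obtain ⟨hseg, h1, h2⟩ := hu
  rw [segment_eq_image_lineMap] at hseg
  obtain ⟨s, hs, rfl⟩ := hseg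
  refine ⟨s, hs, rfl, ?_⟩
  have hsum := γ.length_add ht
  have htop : edist x y + ENNReal.ofReal h ≠ ⊤ := by finiteness
  have hA := ne_top_of_le_ne_top htop (le_self_add.trans hsum)
  have hB := ne_top_of_le_ne_top htop (le_add_self.trans hsum)
  have h3 := γ.edist_le_left ht
  have h4 := γ.edist_le_right ht
  rw [edist_dist, ENNReal.ofReal_le_iff_le_toReal hA] at h1 h3
  rw [edist_dist, ENNReal.ofReal_le_iff_le_toReal hB] at h2 h4
  rw [dist_left_lineMap, hd, Real.norm_of_nonneg hs.1] at h1
  rw [dist_lineMap_right, hd, Real.norm_of_nonneg (sub_nonneg.2 hs.2)] at h2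
  have h5 := ENNReal.toReal_mono htop hsum
  rw [ENNReal.toReal_add hA hB, ENNReal.toReal_add (by finiteness) (by finiteness),
    ENNReal.toReal_ofReal hh, edist_dist, ENNReal.toReal_ofReal dist_nonneg] at h5
  exact apexDist_le hs dist_nonneg dist_nonneg dist_nonneg (by rwa [dist_comm]) h4 h1 h2 h5 hK hhK

end ShortSegment

/-! ### Rough CAT(0) spaces and the five-point inequality -/

/-- The function `H` in the definition of rough CAT(0) spaces. -/
noncomputable abbrev shortness {X : Type u} [MetricSpace X] (x y z : X) : ℝ :=
  1 / max (max (max 1 (dist x y)) (dist x z)) (dist y z)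

theorem shortness_pos {X : Type u} [MetricSpace X] (x y z : X) : 0 < shortness x y z := by
  unfold shortness
  positivity

/-- The distance of a vertex `u` to a point of the opposite side. -/
theorem IsRoughCAT0.dist_apex_le {X : Type u} [MetricSpace X] {C : ℝ} (hX : IsRoughCAT0 C X)
    {h : ℝ} {x y : X} (γ : ShortSegment h x y) (u : X) (hh : h ≤ shortness x y u) {s t : ℝ}
    (hs : s ∈ Set.Icc (0 : ℝ) 1) (ht : t ∈ Set.Icc 0 γ.L)
    (hst : dist x (γ.path t) = s * dist x y) :
    dist u (γ.path t) ≤ apexDist (dist u x) (dist u y) (dist x y) s + C := by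
  obtain ⟨-, hlen, hcat⟩ := hX
  let p : Fin 3 → X := ![x, y, u]
  obtain ⟨σ⟩ : Nonempty (∀ i : Fin 3, ShortSegment (shortness x y u) (p i) (p (i + 1))) :=
    ⟨fun i => (hlen _ _ _ (shortness_pos x y u)).some⟩
  let τ : ∀ i : Fin 3, ShortSegment (shortness x y u) (p i) (p (i + 1)) :=
    Function.update σ 0 (γ.mono hh)
  have hτ : τ 0 = γ.mono hh := Function.update_self ..
  obtain ⟨p', hp'⟩ := exists_comparison_triangle p
  have key := hcat p τ p' hp' 2 0 (by decide) 0 (Set.left_mem_Icc.2 (τ 2).L_nonneg) t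
    (by rw [hτ]; exact ht) (p' 2) (AffineMap.lineMap (p' 0) (p' 1) s)
    ⟨left_mem_segment .., by simp, by
      have := (τ 2).edist_le_right (Set.left_mem_Icc.2 (τ 2).L_nonneg)
      rw [(τ 2).source] at this
      rwa [edist_dist, hp', ← edist_dist]⟩
    (by rw [hτ]; exact (γ.mono hh).isComparisonPoint_lineMap hs ht hst (hp' 0 1))
  rw [(τ 2).source, hτ, dist_lineMap_apex, hp', hp', hp'] at key
  exact key

theorem IsRoughCAT0.fivePointBound {X : Type u} [MetricSpace X] {C : ℝ} (hX : IsRoughCAT0 C X) :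
    FivePointBound (3 * C) X := by
  intro p u v i j hij s hs t ht
  -- The same sides have to be short enough for all three triangles.
  obtain ⟨h, hh0, hh, hhi, hhj⟩ : ∃ h, 0 < h ∧ h ≤ shortness (p 0) (p 1) (p 2) ∧
      h ≤ shortness (p i) (p (i + 1)) u ∧ h ≤ shortness (p j) (p (j + 1)) v :=
    ⟨_, lt_min (lt_min (shortness_pos (p 0) (p 1) (p 2)) (shortness_pos (p i) (p (i + 1)) u))
      (shortness_pos (p j) (p (j + 1)) v), (min_le_left _ _).trans (min_le_left _ _),
      (min_le_left _ _).trans (min_le_right _ _), min_le_right _ _⟩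
  obtain ⟨σ⟩ : Nonempty (∀ k : Fin 3, ShortSegment h (p k) (p (k + 1))) :=
    ⟨fun k => (hX.2.1 _ _ _ hh0).some⟩
  obtain ⟨a, ha, has⟩ := (σ i).exists_dist_eq hs
  obtain ⟨b, hb, hbt⟩ := (σ j).exists_dist_eq ht
  have hu := hX.dist_apex_le (σ i) u hhi hs ha has
  have hv := hX.dist_apex_le (σ j) v hhj ht hb hbt
  obtain ⟨p', hp'⟩ := exists_comparison_triangle p
  have hw := hX.2.2 p (fun k => (σ k).mono hh) p' hp' i j hij a ha b hb _ _
    (((σ i).mono hh).isComparisonPoint_lineMap hs ha has (hp' _ _))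
    (((σ j).mono hh).isComparisonPoint_lineMap ht hb hbt (hp' _ _))
  rw [dist_lineMap_side] at hw
  simp only [hp'] at hw
  change dist ((σ i).path a) ((σ j).path b) ≤ _ at hw
  have h1 := dist_triangle4 u ((σ i).path a) ((σ j).path b) v
  rw [dist_comm ((σ j).path b) v] at h1
  linarith

/-- Conversely, the five-point inequality implies rough comparison for short triangles. -/
theorem FivePointBound.roughCAT0Condition {X : Type u} [MetricSpace X] {c : ℝ}
    (hX : FivePointBound c X) {H : X → X → X → ℝ} (hH : ∀ x y z, 0 ≤ H x y z) {K : ℝ}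
    (hK : 0 ≤ K) (hHK : ∀ (p : Fin 3 → X) (i : Fin 3),
      dist (p i) (p (i + 1)) * H (p 0) (p 1) (p 2) / 2 + H (p 0) (p 1) (p 2) ^ 2 ≤ K ^ 2) :
    RoughCAT0Condition X (c + 2 * K) H := by
  intro p γ p' hp' i j hij s hs t ht u' v' hu hv
  obtain ⟨a, ha, rfl, hua⟩ := hu.exists_lineMap (hH _ _ _) hs (hp' _ _) hK (hHK p i)
  obtain ⟨b, hb, rfl, hvb⟩ := hv.exists_lineMap (hH _ _ _) ht (hp' _ _) hK (hHK p j)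
  have := hX p ((γ i).path s) ((γ j).path t) i j hij a ha b hb
  rw [dist_lineMap_side]
  simp only [hp']
  linarith

theorem FivePointBound.isRoughCAT0 {X : Type u} [MetricSpace X] {C : ℝ} (hC : 0 < C)
    (hX : FivePointBound (3 * C) X) (hlen : IsLengthSpace X) : IsRoughCAT0 (3 * C + 2 * √3) X := by
  refine ⟨by positivity, hlen, hX.roughCAT0Condition (fun x y z => (shortness_pos x y z).le)
    (Real.sqrt_nonneg 3) fun p i => ?_⟩
  rw [Real.sq_sqrt (by norm_num)]
  set M := max (max (max 1 (dist (p 0) (p 1))) (dist (p 0) (p 2))) (dist (p 1) (p 2)) with hM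
  have hM1 : 1 ≤ M := by simp [hM]
  have hd : dist (p i) (p (i + 1)) ≤ M := by
    fin_cases i
    · simp [hM]
    · simp [hM]
    · simp [hM, dist_comm (p 2) (p 0)]
  have hM0 : 0 < M := by linarith
  have h1 : dist (p i) (p (i + 1)) * (1 / M) ≤ 1 := by
    rw [mul_one_div]
    exact div_le_one_of_le₀ hd hM0.le
  have h2 : 1 / M ≤ 1 := div_le_one_of_le₀ hM1 hM0.le
  have h3 : (1 / M) ^ 2 ≤ 1 := pow_le_one₀ (by positivity) h2
  linarith

theorem FivePointBound.isCAT0 {X : Type u} [MetricSpace X] (hX : FivePointBound 0 X)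
    (hgeo : IsGeodesicSpace X) : IsCAT0 X := by
  refine ⟨hgeo, ?_⟩
  simpa using hX.roughCAT0Condition (H := fun _ _ _ => 0) (K := 0) (by simp) le_rfl (by simp)

/-! ### Gromov-Hausdorff limits -/

theorem exists_dist_sub_lt_of_ghEDist_lt {X : Type u} {Y : Type v} [MetricSpace X]
    [MetricSpace Y] {ε : ℝ} (h : ghEDist Y X < ENNReal.ofReal ε) :
    ∃ g : X → Y, ∀ x x', |dist (g x) (g x') - dist x x'| < 2 * ε := by
  simp only [ghEDist, iInf_lt_iff] at h
  obtain ⟨Z, _, f, f', hf, hf', hlt⟩ := h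
  rw [Metric.hausdorffEDist_comm] at hlt
  have hex : ∀ x : X, ∃ y : Y, dist (f' x) (f y) < ε := by
    intro x
    obtain ⟨_, ⟨y, rfl⟩, hy⟩ :=
      Metric.exists_edist_lt_of_hausdorffEDist_lt (Set.mem_range_self x) hlt
    rw [edist_dist] at hy
    exact ⟨y, (ENNReal.ofReal_lt_ofReal_iff_of_nonneg dist_nonneg).1 hy⟩
  choose g hg using hex
  refine ⟨g, fun x x' => ?_⟩
  have h1 := hg x
  have h2 := hg x'
  rw [← hf.dist_eq, ← hf'.dist_eq]
  have h3 := dist_triangle4 (f' x) (f (g x)) (f (g x')) (f' x')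
  have h4 := dist_triangle4 (f (g x)) (f' x) (f' x') (f (g x'))
  rw [dist_comm (f (g x')) (f' x')] at h3
  rw [dist_comm (f (g x)) (f' x)] at h4
  rw [abs_lt]
  constructor <;> linarith

theorem IsGHLimit.exists_dist_sub_lt {Y : ℕ → Type v} [∀ m, MetricSpace (Y m)] {X : Type u}
    [MetricSpace X] (h : IsGHLimit Y X) {ε : ℝ} (hε : 0 < ε) :
    ∃ (m : ℕ) (g : X → Y m), ∀ x x', |dist (g x) (g x') - dist x x'| < 2 * ε := by
  obtain ⟨m, hm⟩ := (h.eventually_lt_const (ENNReal.ofReal_pos.2 hε)).exists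
  exact ⟨m, exists_dist_sub_lt_of_ghEDist_lt hm⟩

theorem tendsto_dist_of_abs_sub_lt {a : ℕ → ℝ} {b : ℝ}
    (h : ∀ᶠ n : ℕ in atTop, |a n - b| < 2 * (1 / ((n : ℝ) + 1))) : Tendsto a atTop (𝓝 b) := by
  have h0 : Tendsto (fun n : ℕ => 2 * (1 / ((n : ℝ) + 1))) atTop (𝓝 0) := by
    simpa using (tendsto_one_div_add_atTop_nhds_zero_nat (𝕜 := ℝ)).const_mul 2
  rw [tendsto_iff_dist_tendsto_zero]
  exact squeeze_zero' (Eventually.of_forall fun _ => dist_nonneg) (h.mono fun _ hn => hn.le) h0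

theorem IsGHLimit.fivePointBound {Y : ℕ → Type v} [∀ m, MetricSpace (Y m)] {X : Type u}
    [MetricSpace X] {c : ℝ} (h : IsGHLimit Y X) (hY : ∀ m, FivePointBound c (Y m)) :
    FivePointBound c X := by
  choose m g hg using fun n : ℕ => h.exists_dist_sub_lt (Nat.one_div_pos_of_nat (α := ℝ) (n := n))
  exact .of_tendsto (l := atTop) (fun n => hY (m n)) tendsto_const_nhds g fun x y =>
    tendsto_dist_of_abs_sub_lt (.of_forall fun n => hg n x y)

theorem IsPointedGHLimit.fivePointBound {Y : ℕ → Type v} [∀ m, MetricSpace (Y m)]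
    {q : ∀ m, Y m} {X : Type u} [MetricSpace X] {p : X} {c : ℝ} (h : IsPointedGHLimit Y q X p)
    (hY : ∀ m, FivePointBound c (Y m)) : FivePointBound c X := by
  -- approximations on larger and larger balls, extended by the constant `q m`
  choose m g hg using fun n : ℕ => (h (n + 1) n.cast_add_one_pos).exists_dist_sub_lt
    (Nat.one_div_pos_of_nat (α := ℝ) (n := n))
  classical
  refine .of_tendsto (l := atTop) (fun n => hY (m n)) tendsto_const_nhds
    (fun n x => if hx : x ∈ Metric.closedBall p (n + 1) then (g n ⟨x, hx⟩ : Y (m n)) else q (m n))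
    fun x y => tendsto_dist_of_abs_sub_lt ?_
  have hball : ∀ x, ∀ᶠ n : ℕ in atTop, x ∈ Metric.closedBall p ((n : ℝ) + 1) := fun x =>
    (tendsto_natCast_atTop_atTop.eventually_ge_atTop (dist x p)).mono fun n hn =>
      Metric.mem_closedBall.2 (by linarith)
  filter_upwards [hball x, hball y] with n hx hy
  rw [dif_pos hx, dif_pos hy]
  exact hg n ⟨x, hx⟩ ⟨y, hy⟩

/-! ### Ultralimits and asymptotic cones -/

/-- The class of a bounded family in the ultralimit. -/
noncomputable def Ultralimit.mk {ι : Type u} {ω : Ultrafilter ι} {Y : ι → Type v} [∀ i, MetricSpace (Y i)]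
    {q : ∀ i, Y i} (x : BoundedFamily ω Y q) : Ultralimit ω Y q :=
  SeparationQuotient.mk x

theorem Ultralimit.mk_surjective {ι : Type u} {ω : Ultrafilter ι} {Y : ι → Type v}
    [∀ i, MetricSpace (Y i)] {q : ∀ i, Y i} :
    Function.Surjective (Ultralimit.mk : BoundedFamily ω Y q → Ultralimit ω Y q) :=
  SeparationQuotient.surjective_mk

theorem Ultralimit.tendsto_dist_mk {ι : Type u} {ω : Ultrafilter ι} {Y : ι → Type v}
    [∀ i, MetricSpace (Y i)] {q : ∀ i, Y i} (x y : BoundedFamily ω Y q) :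
    Tendsto (fun i => dist (x.1 i) (y.1 i)) ω (𝓝 (dist (Ultralimit.mk x) (Ultralimit.mk y))) :=
  tendsto_dist ω Y q x y

theorem FivePointBound.ultralimit {ι : Type u} {ω : Ultrafilter ι} {Y : ι → Type v}
    [∀ i, MetricSpace (Y i)] {q : ∀ i, Y i} {c : ι → ℝ} {c' : ℝ}
    (hY : ∀ i, FivePointBound (c i) (Y i)) (hc : Tendsto c ω (𝓝 c')) :
    FivePointBound c' (Ultralimit ω Y q) := by
  refine .of_tendsto hY hc
    (fun i x => (Function.surjInv Ultralimit.mk_surjective x : BoundedFamily ω Y q).1 i)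
    fun x y => ?_
  simpa only [Function.surjInv_eq] using Ultralimit.tendsto_dist_mk
    (Function.surjInv Ultralimit.mk_surjective x) (Function.surjInv Ultralimit.mk_surjective y)

theorem FivePointBound.of_isometryEquiv {X : Type u} {Y : Type v} [MetricSpace X] [MetricSpace Y]
    {c : ℝ} (hY : FivePointBound c Y) (e : X ≃ᵢ Y) : FivePointBound c X :=
  .of_tendsto (l := (pure () : Filter Unit)) (fun _ => hY) tendsto_const_nhds (fun _ => e)
    fun x y => by simpa only [e.dist_eq] using tendsto_const_nhds

theorem tendsto_div_of_nonPrincipal {ω : Ultrafilter ℕ+} (hω : NonPrincipal ω) (c : ℝ) :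
    Tendsto (fun m : ℕ+ => c / (m : ℝ)) ω (𝓝 0) := by
  have h1 : (ω : Filter ℕ+) ≤ cofinite :=
    ω.le_cofinite_or_eq_pure.resolve_right fun ⟨m, hm⟩ => hω m hm
  have h2 : Tendsto (fun m : ℕ+ => (m : ℕ)) cofinite atTop :=
    Nat.cofinite_eq_atTop ▸ PNat.coe_injective.tendsto_cofinite
  exact ((tendsto_const_div_atTop_nhds_zero_nat c).comp h2).mono_left h1

/-- A map from the unit interval that does not increase distances by more than the factor
`dist x y` is a geodesic. -/
theorem nonempty_geodesic_of_dist_le {X : Type u} [MetricSpace X] {x y : X} {f : ℝ → X}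
    (h0 : f 0 = x) (h1 : f 1 = y)
    (hf : ∀ s ∈ Set.Icc (0 : ℝ) 1, ∀ t ∈ Set.Icc (0 : ℝ) 1, s ≤ t →
      dist (f s) (f t) ≤ dist x y * (t - s)) : Nonempty (ShortSegment 0 x y) := by
  have hL : LipschitzOnWith (nndist x y) f (Set.Icc 0 1) := by
    refine LipschitzOnWith.of_dist_le_mul fun s hs t ht => ?_
    rw [coe_nndist]
    rcases le_total s t with hst | hst
    · rw [dist_comm s, Real.dist_eq, abs_of_nonneg (sub_nonneg.2 hst)]
      exact hf s hs t ht hst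
    · rw [dist_comm (f s), Real.dist_eq, abs_of_nonneg (sub_nonneg.2 hst)]
      exact hf t ht s hs hst
  refine ⟨⟨1, f, zero_le_one, hL.continuousOn, h0, h1, ?_⟩⟩
  have hid : eVariationOn (id : ℝ → ℝ) (Set.Icc 0 1) ≤ 1 := by
    have := (monotone_id.monotoneOn (Set.Icc (0 : ℝ) 1)).eVariationOn_eq
      (Set.left_mem_Icc.2 zero_le_one) (Set.right_mem_Icc.2 zero_le_one)
    rw [Set.inter_self] at this
    simp [this]
  have := hL.comp_eVariationOn_le (g := id) (s := Set.Icc 0 1) (Set.mapsTo_id _)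
  calc eVariationOn f (Set.Icc 0 1) ≤ nndist x y * eVariationOn (id : ℝ → ℝ) (Set.Icc 0 1) := this
    _ ≤ nndist x y * 1 := by gcongr
    _ = edist x y + ENNReal.ofReal 0 := by rw [mul_one, ENNReal.ofReal_zero, add_zero, edist_nndist]

theorem ShortSegment.dist_le_of_dist_eq {X : Type u} [MetricSpace X] {h : ℝ} {x y : X}
    (γ : ShortSegment h x y) (hh : 0 ≤ h) {s s' t t' : ℝ} (hs : s ≤ s') (ht : t ∈ Set.Icc 0 γ.L)
    (ht' : t' ∈ Set.Icc 0 γ.L) (hst : dist x (γ.path t) = s * dist x y)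
    (hst' : dist x (γ.path t') = s' * dist x y) :
    dist (γ.path t) (γ.path t') ≤ dist x y * (s' - s) + h := by
  have h0 : s * dist x y ≤ s' * dist x y := by gcongr
  have k1 := dist_triangle x (γ.path t) y
  have k2 := dist_triangle x (γ.path t') y
  rcases le_total t t' with htt | htt
  · have := γ.dist_add_dist_add_dist_le hh ht.1 htt ht'.2
    linarith
  · have := γ.dist_add_dist_add_dist_le hh ht'.1 htt ht.2
    rw [dist_comm (γ.path t')] at this
    linarith

/-- The asymptotic cones of a length space are geodesic: the points that divide `1`-short
segments in `X` in the ratio `s : 1 - s` converge to the points of a geodesic. -/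
theorem IsLengthSpace.isGeodesicSpace_asymptoticCone {X : Type u} [MetricSpace X]
    (hX : IsLengthSpace X) {ω : Ultrafilter ℕ+} (hω : NonPrincipal ω) (q : ℕ+ → X) :
    IsGeodesicSpace (AsymptoticCone ω X q) := by
  intro x y
  obtain ⟨x, rfl⟩ := Ultralimit.mk_surjective x
  obtain ⟨y, rfl⟩ := Ultralimit.mk_surjective y
  let γ : ∀ m : ℕ+, ShortSegment (X := X) 1 (x.1 m) (y.1 m) := fun m =>
    (hX _ _ 1 one_pos).some
  have hex : ∀ (s : Set.Icc (0 : ℝ) 1) (m : ℕ+), ∃ t ∈ Set.Icc 0 (γ m).L,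
      dist (α := X) (x.1 m) ((γ m).path t) = s * dist (α := X) (x.1 m) (y.1 m) :=
    fun s m => (γ m).exists_dist_eq s.2
  choose τ hτ hτd using hex
  have hd : ∀ (m : ℕ+) (a b : Rescaled X m), dist a b = dist (α := X) a b / (m : ℝ) :=
    fun _ _ _ => rfl
  have hbdd : ∀ s : Set.Icc (0 : ℝ) 1, ∃ B : ℝ, ∀ m : ℕ+,
      dist (Rescaled.mk m ((γ m).path (τ s m))) (Rescaled.mk m (q m)) ≤ B := by
    intro s
    obtain ⟨A, hA⟩ := x.2
    obtain ⟨B, hB⟩ := y.2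
    refine ⟨A + B + A, fun m => ?_⟩
    have hm : (0 : ℝ) < m := by exact_mod_cast m.pos
    have h1 : dist (Rescaled.mk m ((γ m).path (τ s m))) (x.1 m) ≤ dist (x.1 m) (y.1 m) := by
      rw [dist_comm, hd, hd]
      refine div_le_div_of_nonneg_right ?_ hm.le
      exact (hτd s m).trans_le (mul_le_of_le_one_left dist_nonneg s.2.2)
    have h2 := dist_triangle (Rescaled.mk m ((γ m).path (τ s m))) (x.1 m) (Rescaled.mk m (q m))
    have h3 := dist_triangle_right (x.1 m) (y.1 m) (Rescaled.mk m (q m))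
    linarith [hA m, hB m]
  let F : Set.Icc (0 : ℝ) 1 → BoundedFamily ω (Rescaled X) fun m => Rescaled.mk m (q m) :=
    fun s => ⟨fun m => Rescaled.mk m ((γ m).path (τ s m)), hbdd s⟩
  have hF : ∀ s t : Set.Icc (0 : ℝ) 1, s ≤ t →
      dist (Ultralimit.mk (F s)) (Ultralimit.mk (F t)) ≤
        dist (Ultralimit.mk x) (Ultralimit.mk y) * (t - s) := by
    intro s t hst
    have hlim := ((Ultralimit.tendsto_dist_mk x y).mul_const ((t : ℝ) - s)).add
      (tendsto_div_of_nonPrincipal hω 1)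
    rw [add_zero] at hlim
    refine le_of_tendsto_of_tendsto' (Ultralimit.tendsto_dist_mk (F s) (F t)) hlim fun m => ?_
    have hm : (0 : ℝ) < m := by exact_mod_cast m.pos
    rw [hd, hd, div_mul_eq_mul_div, ← add_div]
    exact div_le_div_of_nonneg_right ((γ m).dist_le_of_dist_eq zero_le_one hst (hτ s m) (hτ t m)
      (hτd s m) (hτd t m)) hm.le
  refine nonempty_geodesic_of_dist_le
    (f := fun s => Ultralimit.mk (F (Set.projIcc 0 1 zero_le_one s))) ?_ ?_ ?_
  · refine dist_le_zero.1 (le_of_tendsto' (Ultralimit.tendsto_dist_mk _ _) fun m => ?_)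
    have h0 : dist (α := X) (x.1 m) ((γ m).path (τ ⟨0, Set.left_mem_Icc.2 zero_le_one⟩ m)) = 0 := by
      rw [hτd]
      simp
    rw [Set.projIcc_left, dist_comm, hd]
    exact (div_eq_zero_iff.2 (Or.inl h0)).le
  · refine dist_le_zero.1 (le_of_tendsto_of_tendsto' (Ultralimit.tendsto_dist_mk _ _)
      (tendsto_div_of_nonPrincipal hω 1) fun m => ?_)
    have hm : (0 : ℝ) < m := by exact_mod_cast m.pos
    rw [Set.projIcc_right, hd]
    refine div_le_div_of_nonneg_right ?_ hm.le
    have h1 := (γ m).dist_le_of_dist_eq zero_le_one le_rfl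
      (hτ ⟨1, Set.right_mem_Icc.2 zero_le_one⟩ m) (Set.right_mem_Icc.2 (γ m).L_nonneg)
      (hτd ⟨1, Set.right_mem_Icc.2 zero_le_one⟩ m) (by rw [(γ m).target, one_mul])
    rw [sub_self, mul_zero, zero_add, (γ m).target] at h1
    exact h1
  · intro s hs t ht hst
    have := hF ⟨s, hs⟩ ⟨t, ht⟩ hst
    simp only [Set.projIcc_of_mem _ hs, Set.projIcc_of_mem _ ht]
    exact this

theorem IsRoughCAT0.isCAT0_asymptoticCone {X : Type u} [MetricSpace X] {C : ℝ}
    (hX : IsRoughCAT0 C X) {ω : Ultrafilter ℕ+} (hω : NonPrincipal ω) (q : ℕ+ → X) :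
    IsCAT0 (AsymptoticCone ω X q) :=
  have h : FivePointBound 0 (AsymptoticCone ω X q) :=
    FivePointBound.ultralimit (fun m => hX.fivePointBound.rescaled m)
      (tendsto_div_of_nonPrincipal hω (3 * C))
  h.isCAT0 (hX.2.1.isGeodesicSpace_asymptoticCone hω q)

end RoughCAT0

open RoughCAT0
theorem corollaryC {X : Type*} [MetricSpace X] (hX : IsLengthSpace X) :
    (∀ (C : ℝ) (Y : ℕ → Type*) [∀ m, MetricSpace (Y m)], (∀ m, IsRoughCAT0 C (Y m)) →
      (IsGHLimit Y X → IsRoughCAT0 (3 * C + 2 * √3) X) ∧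
      (∀ (q : ∀ m, Y m) (p : X), IsPointedGHLimit Y q X p → IsRoughCAT0 (3 * C + 2 * √3) X) ∧
      (∀ ω : Ultrafilter ℕ, NonPrincipal ω → ∀ q : ∀ m, Y m,
        Nonempty (X ≃ᵢ Ultralimit ω Y q) → IsRoughCAT0 (3 * C + 2 * √3) X)) ∧
    ((∃ C : ℝ, IsRoughCAT0 C X) →
      ∀ ω : Ultrafilter ℕ+, NonPrincipal ω → ∀ q : ℕ+ → X, IsCAT0 (AsymptoticCone ω X q)) := by
  refine ⟨fun C Y _ hY => ?_, fun ⟨C, hC⟩ ω hω q => hC.isCAT0_asymptoticCone hω q⟩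
  have hC : 0 < C := (hY 0).1
  have hY5 : ∀ m, FivePointBound (3 * C) (Y m) := fun m => (hY m).fivePointBound
  exact ⟨fun h => (h.fivePointBound hY5).isRoughCAT0 hC hX,
    fun q p h => (h.fivePointBound hY5).isRoughCAT0 hC hX,
    fun ω _ q ⟨e⟩ => ((FivePointBound.ultralimit hY5 tendsto_const_nhds).of_isometryEquiv
      e).isRoughCAT0 hC hX⟩
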